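/- Consider the queue $M|G|\infty$ with catastrophes: customers arrive according to a Poisson process of rate $\lambda\ge 0$, catastrophes according to a Poisson process of rate $\nu\ge 0$, the service times are i.i.d. nonnegative random variables with distribution function $B$ and finite mean, and arrivals, service times and catastrophes are mutually independent. There are infinitely many servers, service starts on arrival, a catastrophe immediately removes all customers present, and the system is empty at time $0$. For $t\ge 0$ let $N(t)$ be the number of busy servers at time $t$, i.e. the number of customers with arrival time $a\le t$ and service time $s$ such that $t<a+s$ and no catastrophe occurs in $(a,t]$. Let $M(t)$ be the number of customers served during $[0,t)$, i.e. the number of arrivals with $a+s<t$; here a catastrophe does not change the count $M(t)$, so each arrival is counted according to whether its service time runs out before $t$, whether or not it was removed by a catastrophe. Put $P_{mn}(t)=\mathbb P(N(t)=m,\,M(t)=n)$ and, for complex $y,z$ with $|y|\le 1$, $|z|\le 1$, $$P(y,z,t)=\sum_{n=0}^{\infty}\sum_{m=0}^{\infty} z^n y^m P_{mn}(t).$$ Then, for all $t\ge0$ and all $|y|\le1$, $|z|\le1$, this series converges absolutely and $$P(y,z,t)=P(1,z,t)\,P(y,1,t),$$ where $P(y,1,t)=\sum_{m\ge0}y^m\,\mathbb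 P(N(t)=m)$ is the generating function of the number of busy servers and $P(1,z,t)=\sum_{n\ge0}z^n\,\mathbb P(M(t)=n)$ is the generating function of the number of served customers. -/

import Mathlib

open MeasureTheory ProbabilityTheory
open scoped NNReal ENNReal

noncomputable section

namespace CatastropheQueue

variable {Ω : Type*} [MeasurableSpace Ω]

/-- `K t ω` is the number of events in `[0, t]` of a homogeneous Poisson process of rate `r`:
a counting process started at `0`, with nondecreasing right-continuous paths, independent
increments, and increments over `(s, t]` of Poisson law with parameter `r * (t - s)`. -/
structure IsPoissonProcess (K : ℝ≥0 → Ω → ℕ) (r : ℝ≥0) (P : Measure Ω) : Prop where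
  measurable : ∀ t, Measurable (K t)
  zero : ∀ ω, K 0 ω = 0
  mono : ∀ ω, Monotone fun t => K t ω
  rightCts : ∀ ω t, ContinuousWithinAt (fun s => K s ω) (Set.Ici t) t
  indepIncrements : HasIndepIncrements K P
  increment_law : ∀ s t, s ≤ t →
    P.map (fun ω => K t ω - K s ω) = poissonMeasure (r * (t - s))

/-- The primitive data of the queue `M|G|∞` with catastrophes, empty at time `0`.
`K` counts customer arrivals (Poisson, rate `lam`), `C` counts catastrophes (Poisson, rate `nu`),
and `S n` is the service time of the `n`-th arriving customer (`n = 0, 1, …`). The service times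
are i.i.d. with law `B` of finite mean; arrivals, service times and catastrophes are mutually
independent. -/
structure IsModel (K C : ℝ≥0 → Ω → ℕ) (S : ℕ → Ω → ℝ≥0)
    (lam nu : ℝ≥0) (B : Measure ℝ≥0) (P : Measure Ω) : Prop where
  arrivals : IsPoissonProcess K lam P
  catastrophes : IsPoissonProcess C nu P
  service_measurable : ∀ n, Measurable (S n)
  service_law : ∀ n, P.map (S n) = B
  service_indep : iIndepFun S P
  service_mean : ∫⁻ x, (x : ℝ≥0∞) ∂B ≠ ∞
  indep_arrivals_service : IndepFun (fun ω t => K t ω) (fun ω n => S n ω) P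
  indep_catastrophes :
    IndepFun (fun ω => ((fun t => K t ω, fun n => S n ω) : (ℝ≥0 → ℕ) × (ℕ → ℝ≥0)))
      (fun ω t => C t ω) P

/-- Arrival time of the `n`-th customer (`n = 0, 1, …`): the first time at which more than `n`
customers have arrived. It is used only for customers that do arrive, i.e. `n < K t ω`. -/
def arrivalTime (K : ℝ≥0 → Ω → ℕ) (n : ℕ) (ω : Ω) : ℝ≥0 :=
  sInf {s | n < K s ω}

/-- `N(t)`: the number of busy servers at time `t`. A customer that arrived at time `a ≤ t` with
service time `s` occupies a server at time `t` iff its service is not over (`t < a + s`) and no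
catastrophe has occurred in `(a, t]` (a catastrophe removes all customers present). -/
def busyServers (K C : ℝ≥0 → Ω → ℕ) (S : ℕ → Ω → ℝ≥0) (t : ℝ≥0) (ω : Ω) : ℕ :=
  ((Finset.range (K t ω)).filter fun n =>
    t < arrivalTime K n ω + S n ω ∧ C t ω = C (arrivalTime K n ω) ω).card

/-- `M(t)`: the number of customers served during `[0, t)`, that is, of arrivals whose arrival
time plus service time lies in `[0, t)`. A catastrophe empties the servers but does not act on
this count: each arrival is classified only by whether its service time runs out before `t`. -/
def servedCustomers (K : ℝ≥0 → Ω → ℕ) (S : ℕ → Ω → ℝ≥0) (t : ℝ≥0) (ω : Ω) : ℕ :=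
  ((Finset.range (K t ω)).filter fun n => arrivalTime K n ω + S n ω < t).card

/-- `P_{mn}(t) = P(N(t) = m, M(t) = n)`. -/
def jointProb (K C : ℝ≥0 → Ω → ℕ) (S : ℕ → Ω → ℝ≥0) (P : Measure Ω)
    (m n : ℕ) (t : ℝ≥0) : ℝ :=
  P.real {ω | busyServers K C S t ω = m ∧ servedCustomers K S t ω = n}

/-- The joint generating function `P(y, z, t) = ∑ₙ ∑ₘ zⁿ yᵐ P_{mn}(t)`. -/
def jointPGF (K C : ℝ≥0 → Ω → ℕ) (S : ℕ → Ω → ℝ≥0) (P : Measure Ω)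
    (y z : ℂ) (t : ℝ≥0) : ℂ :=
  ∑' n : ℕ, ∑' m : ℕ, z ^ n * y ^ m * (jointProb K C S P m n t : ℂ)

end CatastropheQueue

end

/-! Write `z ^ M(t) * y ^ N(t)` as a product of one mark per arrival. Given the catastrophe path, a
Poisson stream with independent marks has generating function `exp (rate * (E mark - 1))`. A
customer cannot be both served before `t` and still busy at `t`, so `mark - 1` splits into a
`z`-part plus a `y`-part and the exponential factorizes. Only the `y`-part depends on the
catastrophes, so the `z`-factor is deterministic and leaves the expectation over them.

To avoid conditioning on arrival times, `[0, t]` is cut into `n + 1` intervals and marks use only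
the interval endpoints (`gridApprox`). The factorization is already exact for each `n`
(`integral_gridApprox_eq_mul`). Pathwise, the approximation eventually equals the true product
(`eventually_gridApprox_eq`), and dominated convergence finishes. -/

namespace CatastropheQueue

open Filter Topology

/-! ### Marked Poisson processes on a partition. -/

section

/-- The probability generating function of the Poisson law. -/
theorem integral_pow_poissonMeasure (r : ℝ≥0) (w : ℂ) :
    ∫ k, w ^ k ∂(poissonMeasure r) = Complex.exp (r * (w - 1)) := by
  rw [integral_poissonMeasure]
  have h : HasSum (fun k : ℕ => (r * w : ℂ) ^ k / (k.factorial : ℂ)) (Complex.exp (r * w)) := by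
    rw [Complex.exp_eq_exp_ℂ]
    exact NormedSpace.expSeries_div_hasSum_exp (r * w : ℂ)
  have h2 := (h.mul_left (Complex.exp (-r))).tsum_eq
  rw [← Complex.exp_add] at h2
  rw [show (r * (w - 1) : ℂ) = -r + r * w by ring, ← h2]
  refine tsum_congr fun k => ?_
  rw [Complex.real_smul]
  push_cast
  rw [mul_pow]
  ring

/-- Fubini's theorem for a bounded function of two independent random variables. -/
theorem integral_eq_integral_integral_of_indepFun {Ω E F : Type*} [MeasurableSpace Ω]
    [MeasurableSpace E] [MeasurableSpace F] {P : Measure Ω} [IsProbabilityMeasure P]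
    {X : Ω → E} {Y : Ω → F} (hX : Measurable X) (hY : Measurable Y) (hXY : IndepFun X Y P)
    {G : E → F → ℂ} (hG : Measurable (Function.uncurry G)) (hG1 : ∀ x y, ‖G x y‖ ≤ 1) :
    ∫ ω, G (X ω) (Y ω) ∂P = ∫ ω, ∫ ω', G (X ω) (Y ω') ∂P ∂P := by
  have : IsProbabilityMeasure (P.map X) := Measure.isProbabilityMeasure_map hX.aemeasurable
  have : IsProbabilityMeasure (P.map Y) := Measure.isProbabilityMeasure_map hY.aemeasurable
  have h1 : ∫ ω, G (X ω) (Y ω) ∂P =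
      ∫ p, Function.uncurry G p ∂(P.map fun ω => (X ω, Y ω)) := by
    rw [integral_map (hX.prodMk hY).aemeasurable hG.aestronglyMeasurable]
    rfl
  have hint : Integrable (Function.uncurry G) ((P.map X).prod (P.map Y)) :=
    Integrable.of_bound hG.aestronglyMeasurable 1 (ae_of_all _ fun p => hG1 p.1 p.2)
  rw [h1, hXY.map_prod_eq_prod_map_map hX.aemeasurable hY.aemeasurable, integral_prod _ hint,
    integral_map hX.aemeasurable hint.aestronglyMeasurable.integral_prod_right']
  refine integral_congr_ae (ae_of_all _ fun ω => ?_)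
  exact integral_map hY.aemeasurable
    (hG.comp (measurable_const.prodMk measurable_id)).aestronglyMeasurable

/-- A product over consecutive blocks is a product over one interval. -/
theorem prod_prod_Ico_eq {M : Type*} [CommMonoid M] {k : ℕ → ℕ} (hk : Monotone k) (g : ℕ → M)
    (n : ℕ) :
    ∏ i ∈ Finset.range n, ∏ j ∈ Finset.Ico (k i) (k (i + 1)), g j =
      ∏ j ∈ Finset.Ico (k 0) (k n), g j := by
  induction n with
  | zero => simp
  | succ n ih =>
    rw [Finset.prod_range_succ, ih,
      Finset.prod_Ico_consecutive _ (hk (Nat.zero_le n)) (hk n.le_succ)]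

/-- The index of the block that contains a given number. -/
theorem sInf_lt_succ_eq {k : ℕ → ℕ} (hk : Monotone k) {i j : ℕ}
    (hj : j ∈ Finset.Ico (k i) (k (i + 1))) : sInf {i | j < k (i + 1)} = i := by
  rw [Finset.mem_Ico] at hj
  refine le_antisymm (Nat.sInf_le hj.2) ?_
  refine le_csInf ⟨i, hj.2⟩ fun i' (hi' : j < k (i' + 1)) => ?_
  by_contra! h
  exact absurd (hk h : k (i' + 1) ≤ k i) (by omega)

theorem norm_prod_prod_le_one {f : ℕ → ℕ → ℂ} (hf : ∀ i j, ‖f i j‖ ≤ 1) (n : ℕ) (a b : ℕ → ℕ) :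
    ‖∏ i ∈ Finset.range n, ∏ j ∈ Finset.Ico (a i) (b i), f i j‖ ≤ 1 := by
  rw [norm_prod]
  refine Finset.prod_le_one (fun _ _ => norm_nonneg _) fun i _ => ?_
  rw [norm_prod]
  exact Finset.prod_le_one (fun _ _ => norm_nonneg _) fun j _ => hf i j

theorem measurable_prod_Ico {E : Type*} [MeasurableSpace E] {a b : E → ℕ} (ha : Measurable a)
    (hb : Measurable b) {g : ℕ → E → ℂ} (hg : ∀ j, Measurable (g j)) :
    Measurable fun x => ∏ j ∈ Finset.Ico (a x) (b x), g j x := by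
  have h : Measurable fun p : (ℕ × ℕ) × E => ∏ j ∈ Finset.Ico p.1.1 p.1.2, g j p.2 :=
    measurable_from_prod_countable_right fun q =>
      Finset.measurable_fun_prod (Finset.Ico q.1 q.2) fun j _ => hg j
  exact h.comp ((ha.prodMk hb).prodMk measurable_id)

variable {Ω : Type*} [MeasurableSpace Ω] {P : Measure Ω}

/-- Product, over consecutive blocks of indices, of functions of i.i.d. random variables. -/
theorem integral_prod_blocks {S : ℕ → Ω → ℝ≥0} {B : Measure ℝ≥0} (hS : ∀ j, Measurable (S j))
    (hB : ∀ j, P.map (S j) = B) (hind : iIndepFun S P) {f : ℕ → ℝ≥0 → ℂ}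
    (hf : ∀ i, Measurable (f i)) {k : ℕ → ℕ} (hk : Monotone k) (n : ℕ) :
    ∫ ω, ∏ i ∈ Finset.range n, ∏ j ∈ Finset.Ico (k i) (k (i + 1)), f i (S j ω) ∂P =
      ∏ i ∈ Finset.range n, (∫ s, f i s ∂B) ^ (k (i + 1) - k i) := by
  -- Relabel the functions by the customer index alone, so that one product formula for independent
  -- variables covers all blocks.
  set g : ℕ → ℝ≥0 → ℂ := fun j => f (sInf {i | j < k (i + 1)})
  have hg : ∀ i, ∀ j ∈ Finset.Ico (k i) (k (i + 1)), f i = g j := fun i j hj => by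
    simp only [g, sInf_lt_succ_eq hk hj]
  have hgm : ∀ j, Measurable (g j) := fun j => hf _
  have h1 : ∀ ω, ∏ i ∈ Finset.range n, ∏ j ∈ Finset.Ico (k i) (k (i + 1)), f i (S j ω) =
      ∏ j : Finset.Ico (k 0) (k n), g j (S j ω) := fun ω => by
    rw [Finset.prod_coe_sort (Finset.Ico (k 0) (k n)) fun j => g j (S j ω),
      ← prod_prod_Ico_eq hk]
    exact Finset.prod_congr rfl fun i _ => Finset.prod_congr rfl fun j hj => by rw [hg i j hj]
  have h2 : iIndepFun (fun j : Finset.Ico (k 0) (k n) => S j) P :=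
    hind.precomp Subtype.val_injective
  simp_rw [h1]
  rw [h2.integral_fun_prod_comp (f := fun j : Finset.Ico (k 0) (k n) => g j)
      (fun j => (hS j).aemeasurable) fun j => (hgm j).aestronglyMeasurable,
    Finset.prod_coe_sort (Finset.Ico (k 0) (k n)) fun j => ∫ ω, g j (S j ω) ∂P,
    ← prod_prod_Ico_eq hk]
  refine Finset.prod_congr rfl fun i _ => ?_
  rw [← Nat.card_Ico, ← Finset.prod_const]
  refine Finset.prod_congr rfl fun j hj => ?_
  rw [hg i j hj, ← hB j, integral_map (hS j).aemeasurable (hgm j).aestronglyMeasurable]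

variable [IsProbabilityMeasure P]

/-- Marking of a Poisson process along a partition of the time axis. -/
theorem IsPoissonProcess.integral_prod_blocks {K : ℝ≥0 → Ω → ℕ} {lam : ℝ≥0}
    (hK : IsPoissonProcess K lam P) {S : ℕ → Ω → ℝ≥0} {B : Measure ℝ≥0}
    (hS : ∀ j, Measurable (S j)) (hB : ∀ j, P.map (S j) = B) (hind : iIndepFun S P)
    (hKS : IndepFun (fun ω t => K t ω) (fun ω n => S n ω) P) {f : ℕ → ℝ≥0 → ℂ}
    (hf : ∀ i, Measurable (f i)) (hf1 : ∀ i s, ‖f i s‖ ≤ 1) {τ : ℕ → ℝ≥0} (hτ : Monotone τ)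
    (n : ℕ) :
    ∫ ω, ∏ i ∈ Finset.range n, ∏ j ∈ Finset.Ico (K (τ i) ω) (K (τ (i + 1)) ω), f i (S j ω) ∂P =
      ∏ i ∈ Finset.range n,
        Complex.exp ((lam * (τ (i + 1) - τ i) : ℝ≥0) * (∫ s, f i s ∂B - 1)) := by
  have hKm : Measurable fun ω t => K t ω := measurable_pi_lambda _ hK.measurable
  have hSm : Measurable fun ω n => S n ω := measurable_pi_lambda _ hS
  have h1 := integral_eq_integral_integral_of_indepFun hKm hSm hKS
    (G := fun κ s => ∏ i ∈ Finset.range n,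
      ∏ j ∈ Finset.Ico (κ (τ i)) (κ (τ (i + 1))), f i (s j))
    (Finset.measurable_fun_prod _ fun i _ => measurable_prod_Ico
      ((measurable_pi_apply _).comp measurable_fst) ((measurable_pi_apply _).comp measurable_fst)
      fun j => (hf i).comp ((measurable_pi_apply j).comp measurable_snd))
    (fun κ s => norm_prod_prod_le_one (fun i j => hf1 i (s j)) n _ _)
  rw [h1]
  have h2 : ∀ ω, ∫ ω', ∏ i ∈ Finset.range n,
      ∏ j ∈ Finset.Ico (K (τ i) ω) (K (τ (i + 1)) ω), f i (S j ω') ∂P =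
      ∏ i : Fin n, (∫ s, f i s ∂B) ^ (K (τ (i + 1)) ω - K (τ i) ω) := fun ω => by
    rw [CatastropheQueue.integral_prod_blocks hS hB hind hf (k := fun i => K (τ i) ω)
      (fun _ _ h => hK.mono ω (hτ h)),
      Finset.prod_range fun i => (∫ s, f i s ∂B) ^ (K (τ (i + 1)) ω - K (τ i) ω)]
  simp_rw [h2]
  have h3 : iIndepFun (fun (i : Fin n) ω => K (τ (i + 1)) ω - K (τ i) ω) P :=
    (hK.indepIncrements.nat hτ).precomp (g := fun i : Fin n => (i : ℕ)) Fin.val_injective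
  have hm : ∀ i : ℕ, Measurable fun ω => K (τ (i + 1)) ω - K (τ i) ω := fun i =>
    (hK.measurable _).sub (hK.measurable _)
  rw [h3.integral_fun_prod_comp (f := fun (i : Fin n) k => (∫ s, f i s ∂B) ^ k)
      (fun i => (hm i).aemeasurable) fun i => Measurable.of_discrete.aestronglyMeasurable,
    Finset.prod_range]
  refine Finset.prod_congr rfl fun i _ => ?_
  rw [← integral_pow_poissonMeasure, ← hK.increment_law _ _ (hτ (Nat.le_succ i)),
    integral_map (hm i).aemeasurable Measurable.of_discrete.aestronglyMeasurable]

end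

/-! ### Marks on a grid and their pathwise limit. -/

section

/-- The mark of a customer with service time `s` whose arrival time is known to lie in `[l, r]`:
`z` if the service is surely over before `t`, `y` if it surely ends after `t`. -/
noncomputable def mark (t l r : ℝ≥0) (y z : ℂ) (s : ℝ≥0) : ℂ :=
  (if r + s < t then z else 1) * (if t < l + s then y else 1)

/-- The `z`-test uses the right endpoint and the `y`-test the left one, so they exclude each other
on any grid, however coarse: at least one factor of the mark is `1`. -/
theorem mark_eq_add {t l r : ℝ≥0} (hlr : l ≤ r) (y z : ℂ) (s : ℝ≥0) :
    mark t l r y z s = mark t l r 1 z s + mark t l r y 1 s - 1 := by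
  have h : r + s < t → ¬ t < l + s := fun h1 h2 =>
    absurd (h1.trans h2) (not_lt.2 (by gcongr))
  unfold mark
  split_ifs <;> simp_all

theorem norm_mark_le_one (t l r : ℝ≥0) {y z : ℂ} (hy : ‖y‖ ≤ 1) (hz : ‖z‖ ≤ 1) (s : ℝ≥0) :
    ‖mark t l r y z s‖ ≤ 1 := by
  rw [mark, norm_mul]
  refine mul_le_one₀ ?_ (norm_nonneg _) ?_ <;> split_ifs <;> simp [hy, hz]

theorem measurable_mark_comp {E : Type*} [MeasurableSpace E] (t l r : ℝ≥0) (z : ℂ) {y : E → ℂ}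
    {s : E → ℝ≥0} (hy : Measurable y) (hs : Measurable s) :
    Measurable fun x => mark t l r (y x) z (s x) := by
  unfold mark
  exact (Measurable.ite (measurableSet_lt (hs.const_add r) measurable_const) measurable_const
    measurable_const).mul (Measurable.ite (measurableSet_lt measurable_const (hs.const_add l))
    hy measurable_const)

theorem measurable_mark (t l r : ℝ≥0) (y z : ℂ) : Measurable (mark t l r y z) :=
  measurable_mark_comp t l r z measurable_const measurable_id

theorem integral_mark_sub_one (B : Measure ℝ≥0) [IsProbabilityMeasure B] {t l r : ℝ≥0}
    (hlr : l ≤ r) {y z : ℂ} (hy : ‖y‖ ≤ 1) (hz : ‖z‖ ≤ 1) :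
    ∫ s, mark t l r y z s ∂B - 1 =
      (∫ s, mark t l r 1 z s ∂B - 1) + (∫ s, mark t l r y 1 s ∂B - 1) := by
  have hint : ∀ {y z : ℂ}, ‖y‖ ≤ 1 → ‖z‖ ≤ 1 → Integrable (mark t l r y z) B := fun hy hz =>
    Integrable.of_bound (measurable_mark t l r _ _).aestronglyMeasurable 1
      (ae_of_all _ (norm_mark_le_one t l r hy hz))
  have h1 : ‖(1 : ℂ)‖ ≤ 1 := by simp
  simp_rw [mark_eq_add hlr y z]
  rw [integral_sub (f := fun s => mark t l r 1 z s + mark t l r y 1 s)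
      ((hint h1 hz).add (hint hy h1)) (integrable_const _),
    integral_add (hint h1 hz) (hint hy h1)]
  simp
  ring

/-- The points of the uniform partition of `[0, t]` into `n + 1` intervals. -/
noncomputable def gridTime (t : ℝ≥0) (n i : ℕ) : ℝ≥0 := t * i / (n + 1)

theorem gridTime_mono (t : ℝ≥0) (n : ℕ) : Monotone (gridTime t n) := fun i j h => by
  unfold gridTime
  gcongr

theorem gridTime_zero (t : ℝ≥0) (n : ℕ) : gridTime t n 0 = 0 := by simp [gridTime]

theorem gridTime_last (t : ℝ≥0) (n : ℕ) : gridTime t n (n + 1) = t := by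
  unfold gridTime
  push_cast
  field_simp

theorem gridTime_succ (t : ℝ≥0) (n i : ℕ) :
    gridTime t n (i + 1) = gridTime t n i + t / (n + 1) := by
  unfold gridTime
  push_cast
  ring

variable {Ω : Type*}

/-- Approximation of `z ^ M(t) * y ^ N(t)` in which arrival times are known only up to the
partition of `[0, t]` into `n + 1` intervals. -/
noncomputable def gridApprox (K C : ℝ≥0 → Ω → ℕ) (S : ℕ → Ω → ℝ≥0) (t : ℝ≥0) (y z : ℂ) (n : ℕ)
    (ω : Ω) : ℂ :=
  ∏ i ∈ Finset.range (n + 1),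
    ∏ j ∈ Finset.Ico (K (gridTime t n i) ω) (K (gridTime t n (i + 1)) ω),
      mark t (gridTime t n i) (gridTime t n (i + 1))
        (if C t ω = C (gridTime t n (i + 1)) ω then y else 1) z (S j ω)

theorem norm_gridApprox_le_one (K C : ℝ≥0 → Ω → ℕ) (S : ℕ → Ω → ℝ≥0) (t : ℝ≥0) {y z : ℂ}
    (hy : ‖y‖ ≤ 1) (hz : ‖z‖ ≤ 1) (n : ℕ) (ω : Ω) : ‖gridApprox K C S t y z n ω‖ ≤ 1 :=
  norm_prod_prod_le_one (f := fun i j => mark t (gridTime t n i) (gridTime t n (i + 1))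
    (if C t ω = C (gridTime t n (i + 1)) ω then y else 1) z (S j ω))
    (fun i j => norm_mark_le_one _ _ _ (by split_ifs <;> simp [hy]) hz _) _ _ _

/-- The contribution of one customer to `z ^ M(t) * y ^ N(t)`. -/
noncomputable def exactMark (K C : ℝ≥0 → Ω → ℕ) (S : ℕ → Ω → ℝ≥0) (t : ℝ≥0) (y z : ℂ) (ω : Ω)
    (j : ℕ) : ℂ :=
  (if arrivalTime K j ω + S j ω < t then z else 1) *
    (if t < arrivalTime K j ω + S j ω ∧ C t ω = C (arrivalTime K j ω) ω then y else 1)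

theorem prod_exactMark (K C : ℝ≥0 → Ω → ℕ) (S : ℕ → Ω → ℝ≥0) (t : ℝ≥0) (y z : ℂ) (ω : Ω) :
    ∏ j ∈ Finset.range (K t ω), exactMark K C S t y z ω j =
      z ^ servedCustomers K S t ω * y ^ busyServers K C S t ω := by
  simp only [exactMark, Finset.prod_mul_distrib, Finset.prod_ite, Finset.prod_const,
    one_pow, mul_one, servedCustomers, busyServers]

/-- Strict inequalities survive a small shift of the arrival time, and if service ends exactly at
`t` neither test succeeds. Catastrophes are read at the right endpoint, so right-continuity
suffices. -/
theorem eventually_mark_eq_exactMark (K C : ℝ≥0 → Ω → ℕ) (S : ℕ → Ω → ℝ≥0) (t : ℝ≥0) (y z : ℂ)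
    (ω : Ω) (hC : ∀ u, ContinuousWithinAt (fun s => C s ω) (Set.Ici u) u) (j : ℕ) :
    ∀ᶠ n : ℕ in atTop, ∀ i, gridTime t n i ≤ arrivalTime K j ω →
      arrivalTime K j ω ≤ gridTime t n (i + 1) →
      mark t (gridTime t n i) (gridTime t n (i + 1))
        (if C t ω = C (gridTime t n (i + 1)) ω then y else 1) z (S j ω) =
      exactMark K C S t y z ω j := by
  set a := arrivalTime K j ω
  have hδ : Tendsto (fun n : ℕ => t / ((n : ℝ≥0) + 1)) atTop (𝓝 0) := by
    rw [← NNReal.tendsto_coe]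
    push_cast
    exact tendsto_const_div_atTop_nhds_zero_nat (t : ℝ) |>.comp (tendsto_add_atTop_nat 1)
      |>.congr fun n => by simp
  -- A right-continuous integer-valued path is constant just to the right of `a`.
  have hC' : ∀ᶠ s in 𝓝[≥] a, C s ω = C a ω := by
    have := hC a
    rw [ContinuousWithinAt, nhds_discrete, tendsto_pure] at this
    exact this
  obtain ⟨b, hab, hb⟩ := (mem_nhdsGE_iff_exists_Ico_subset.1 hC' :
    ∃ b ∈ Set.Ioi a, Set.Ico a b ⊆ {s | C s ω = C a ω})
  have e1 : ∀ᶠ n : ℕ in atTop, a + t / ((n : ℝ≥0) + 1) < b :=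
    (hδ.const_add a).eventually_lt_const (by simpa using hab)
  have e2 : ∀ᶠ n : ℕ in atTop, a + S j ω < t → a + t / ((n : ℝ≥0) + 1) + S j ω < t := by
    by_cases h : a + S j ω < t
    · filter_upwards [((hδ.const_add a).add_const (S j ω)).eventually_lt_const
        (by simpa using h)] with n hn _ using hn
    · exact Eventually.of_forall fun n h' => absurd h' h
  -- The mesh is added to `t` rather than subtracted from `a`, since subtraction in `ℝ≥0` truncates.
  have e3 : ∀ᶠ n : ℕ in atTop, t < a + S j ω → t + t / ((n : ℝ≥0) + 1) < a + S j ω := by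
    by_cases h : t < a + S j ω
    · filter_upwards [(hδ.const_add t).eventually_lt_const
        (by simpa using h)] with n hn _ using hn
    · exact Eventually.of_forall fun n h' => absurd h' h
  filter_upwards [e1, e2, e3] with n h1 h2 h3 i hl hr
  have hsucc := gridTime_succ t n i
  set l := gridTime t n i
  set r := gridTime t n (i + 1)
  set δ := t / ((n : ℝ≥0) + 1)
  have hra : r ≤ a + δ := hsucc ▸ (by gcongr)
  have hCr : C r ω = C a ω := hb ⟨hr, hra.trans_lt h1⟩
  have hz : r + S j ω < t ↔ a + S j ω < t :=
    ⟨fun h => lt_of_le_of_lt (by gcongr) h, fun h => lt_of_le_of_lt (by gcongr) (h2 h)⟩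
  have hy : t < l + S j ω ↔ t < a + S j ω := by
    refine ⟨fun h => h.trans_le (by gcongr), fun h => ?_⟩
    have h4 : t + δ < l + S j ω + δ :=
      (h3 h).trans_le (by rw [add_right_comm, ← hsucc]; gcongr)
    exact lt_of_add_lt_add_right h4
  unfold mark exactMark
  rw [hCr]
  simp only [hz, hy, a]
  congr 1
  split_ifs <;> simp_all

/-- Only finitely many customers arrive by `t`, so one `n` works for all of them; `K l ≤ j < K r`
places the arrival time of customer `j` in `[l, r]`. -/
theorem eventually_gridApprox_eq {K C : ℝ≥0 → Ω → ℕ} {S : ℕ → Ω → ℝ≥0} (t : ℝ≥0) (y z : ℂ)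
    (ω : Ω) (hK0 : K 0 ω = 0) (hK : Monotone fun t => K t ω)
    (hC : ∀ u, ContinuousWithinAt (fun s => C s ω) (Set.Ici u) u) :
    ∀ᶠ n in atTop, gridApprox K C S t y z n ω =
      z ^ servedCustomers K S t ω * y ^ busyServers K C S t ω := by
  have h : ∀ᶠ n : ℕ in atTop, ∀ j ∈ Finset.range (K t ω), _ :=
    (Finset.eventually_all (Finset.range (K t ω))).2 fun j _ =>
      eventually_mark_eq_exactMark K C S t y z ω hC j
  filter_upwards [h] with n hn
  have hm : Monotone fun i => K (gridTime t n i) ω := fun _ _ h => hK (gridTime_mono t n h)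
  rw [← prod_exactMark, Finset.range_eq_Ico]
  have := prod_prod_Ico_eq hm (exactMark K C S t y z ω) (n + 1)
  simp only [gridTime_zero, hK0, gridTime_last] at this
  rw [← this]
  refine Finset.prod_congr rfl fun i hi => Finset.prod_congr rfl fun j hj => ?_
  rw [Finset.mem_Ico] at hj
  refine hn j ?_ i ?_ (csInf_le (OrderBot.bddBelow _) hj.2)
  · rw [Finset.mem_range]
    refine hj.2.trans_le ?_
    have := hm (Finset.mem_range.1 hi : i + 1 ≤ n + 1)
    simpa only [gridTime_last] using this
  · refine le_csInf ⟨_, hj.2⟩ fun s (hs : j < K s ω) => ?_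
    by_contra! h
    exact absurd (hs.trans_le (hK h.le : K s ω ≤ K (gridTime t n i) ω)) (not_lt.2 hj.1)

end

/-! ### Measurability, expectations and generating functions. -/

section

variable {Ω : Type*} [MeasurableSpace Ω] {P : Measure Ω} {K C : ℝ≥0 → Ω → ℕ} {S : ℕ → Ω → ℝ≥0}
  {lam nu : ℝ≥0} {B : Measure ℝ≥0}

theorem measurable_gridApprox (hK : ∀ s, Measurable (K s)) (hC : ∀ s, Measurable (C s))
    (hS : ∀ j, Measurable (S j)) (t : ℝ≥0) (y z : ℂ) (n : ℕ) :
    Measurable (gridApprox K C S t y z n) :=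
  Finset.measurable_fun_prod _ fun _ _ => measurable_prod_Ico (hK _) (hK _) fun j =>
    measurable_mark_comp _ _ _ _
      (Measurable.ite (measurableSet_eq_fun (hC _) (hC _)) measurable_const measurable_const)
      (hS j)

theorem IsModel.tendsto_gridApprox (h : IsModel K C S lam nu B P) (t : ℝ≥0) (y z : ℂ) (ω : Ω) :
    Tendsto (fun n => gridApprox K C S t y z n ω) atTop
      (𝓝 (z ^ servedCustomers K S t ω * y ^ busyServers K C S t ω)) :=
  tendsto_nhds_of_eventually_eq (eventually_gridApprox_eq t y z ω (h.arrivals.zero ω)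
    (h.arrivals.mono ω) (h.catastrophes.rightCts ω))

theorem IsModel.measurable_pow_mul_pow (h : IsModel K C S lam nu B P) (t : ℝ≥0) (y z : ℂ) :
    Measurable fun ω => z ^ servedCustomers K S t ω * y ^ busyServers K C S t ω :=
  measurable_of_tendsto_metrizable (fun n => measurable_gridApprox h.arrivals.measurable
    h.catastrophes.measurable h.service_measurable t y z n)
    (tendsto_pi_nhds.2 (h.tendsto_gridApprox t y z))

/-- The powers of `1 / 2` are distinct, so they encode `X`; this recovers the measurability of the
counts from that of the limit of `gridApprox`. -/
theorem measurable_of_measurable_half_pow {Ω : Type*} [MeasurableSpace Ω] {X : Ω → ℕ}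
    (hX : Measurable fun ω => (1 / 2 : ℂ) ^ X ω) : Measurable X := by
  refine measurable_to_countable' fun n => ?_
  have : X ⁻¹' {n} = (fun ω => (1 / 2 : ℂ) ^ X ω) ⁻¹' {(1 / 2 : ℂ) ^ n} := by
    ext ω
    refine ⟨fun hω => by simp_all, fun hω => ?_⟩
    have h2 := congrArg norm (Set.mem_singleton_iff.1 hω)
    simp only [norm_pow] at h2
    exact (pow_right_inj₀ (by norm_num) (by norm_num)).1 h2
  rw [this]
  exact hX (measurableSet_singleton _)

theorem IsModel.measurable_servedCustomers (h : IsModel K C S lam nu B P) (t : ℝ≥0) :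
    Measurable (servedCustomers K S t) :=
  measurable_of_measurable_half_pow (by simpa using h.measurable_pow_mul_pow t 1 (1 / 2))

theorem IsModel.measurable_busyServers (h : IsModel K C S lam nu B P) (t : ℝ≥0) :
    Measurable (busyServers K C S t) :=
  measurable_of_measurable_half_pow (by simpa using h.measurable_pow_mul_pow t (1 / 2) 1)

variable [IsProbabilityMeasure P]

theorem IsModel.isProbabilityMeasure (h : IsModel K C S lam nu B P) : IsProbabilityMeasure B :=
  h.service_law 0 ▸ Measure.isProbabilityMeasure_map (h.service_measurable 0).aemeasurable

/-- The generating function of the approximation, given the catastrophes. -/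
theorem IsModel.integral_gridApprox (h : IsModel K C S lam nu B P) (t : ℝ≥0) {y z : ℂ}
    (hy : ‖y‖ ≤ 1) (hz : ‖z‖ ≤ 1) (n : ℕ) :
    ∫ ω, gridApprox K C S t y z n ω ∂P = ∫ ω, ∏ i ∈ Finset.range (n + 1),
      Complex.exp ((lam * (gridTime t n (i + 1) - gridTime t n i) : ℝ≥0) *
        (∫ s, mark t (gridTime t n i) (gridTime t n (i + 1))
          (if C t ω = C (gridTime t n (i + 1)) ω then y else 1) z s ∂B - 1)) ∂P := by
  have hCm : Measurable fun ω s => C s ω := measurable_pi_lambda _ h.catastrophes.measurable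
  have hKm : Measurable fun ω s => K s ω := measurable_pi_lambda _ h.arrivals.measurable
  have hSm : Measurable fun ω j => S j ω := measurable_pi_lambda _ h.service_measurable
  have hy' : ∀ (c : ℝ≥0 → ℕ) r, ‖if c t = c r then y else 1‖ ≤ 1 := fun c r => by
    split_ifs <;> simp [hy]
  -- To exhibit the integrand as a function of the two independent pieces, `gridApprox` is evaluated
  -- on the canonical space of arrival paths, service sequences and catastrophe paths.
  refine (integral_eq_integral_integral_of_indepFun hCm (hKm.prodMk hSm)
    h.indep_catastrophes.symm (G := fun c p => gridApprox (fun s (p : (ℝ≥0 → ℕ) × (ℕ → ℝ≥0) ×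
      (ℝ≥0 → ℕ)) => p.1 s) (fun s p => p.2.2 s) (fun j p => p.2.1 j) t y z n (p.1, p.2, c))
    ?_ fun c p => norm_gridApprox_le_one _ _ _ _ hy hz _ _).trans ?_
  · refine (measurable_gridApprox (fun s => (measurable_pi_apply s).comp measurable_fst)
      (fun s => (measurable_pi_apply s).comp (measurable_snd.comp measurable_snd))
      (fun j => (measurable_pi_apply j).comp (measurable_fst.comp measurable_snd)) t y z n).comp
      (g := _) ((measurable_fst.comp measurable_snd).prodMk
        ((measurable_snd.comp measurable_snd).prodMk measurable_fst))
  · refine integral_congr_ae (ae_of_all _ fun ω => ?_)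
    exact h.arrivals.integral_prod_blocks h.service_measurable h.service_law h.service_indep
      h.indep_arrivals_service (f := fun i => mark t (gridTime t n i) (gridTime t n (i + 1))
        (if C t ω = C (gridTime t n (i + 1)) ω then y else 1) z)
      (fun i => measurable_mark _ _ _ _ _) (fun i s => norm_mark_le_one _ _ _
        (hy' (fun s => C s ω) _) hz s) (gridTime_mono t n) (n + 1)

theorem IsModel.integral_gridApprox_eq_mul (h : IsModel K C S lam nu B P) (t : ℝ≥0) {y z : ℂ}
    (hy : ‖y‖ ≤ 1) (hz : ‖z‖ ≤ 1) (n : ℕ) :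
    ∫ ω, gridApprox K C S t y z n ω ∂P =
      (∫ ω, gridApprox K C S t 1 z n ω ∂P) * ∫ ω, gridApprox K C S t y 1 n ω ∂P := by
  have := h.isProbabilityMeasure
  have h1 : ‖(1 : ℂ)‖ ≤ 1 := by simp
  rw [h.integral_gridApprox t hy hz, h.integral_gridApprox t h1 hz, h.integral_gridApprox t hy h1]
  -- For `y = 1` the catastrophe test has no effect, so that expectation is of a constant.
  simp only [ite_self, integral_const, probReal_univ, one_smul]
  rw [← integral_const_mul]
  refine integral_congr_ae (ae_of_all _ fun ω => ?_)
  simp only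
  rw [← Finset.prod_mul_distrib]
  refine Finset.prod_congr rfl fun i _ => ?_
  rw [integral_mark_sub_one B (gridTime_mono t n i.le_succ) (by split_ifs <;> simp [hy]) hz,
    mul_add, Complex.exp_add]

theorem IsModel.tendsto_integral_gridApprox (h : IsModel K C S lam nu B P) (t : ℝ≥0) {y z : ℂ}
    (hy : ‖y‖ ≤ 1) (hz : ‖z‖ ≤ 1) :
    Tendsto (fun n => ∫ ω, gridApprox K C S t y z n ω ∂P) atTop
      (𝓝 (∫ ω, z ^ servedCustomers K S t ω * y ^ busyServers K C S t ω ∂P)) :=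
  tendsto_integral_of_dominated_convergence (fun _ => 1)
    (fun n => (measurable_gridApprox h.arrivals.measurable h.catastrophes.measurable
      h.service_measurable t y z n).aestronglyMeasurable) (integrable_const _)
    (fun n => ae_of_all _ (norm_gridApprox_le_one K C S t hy hz n))
    (ae_of_all _ (h.tendsto_gridApprox t y z))

/-- Factorization of the joint generating function, written as an expectation. -/
theorem IsModel.integral_pow_mul_pow (h : IsModel K C S lam nu B P) (t : ℝ≥0) {y z : ℂ}
    (hy : ‖y‖ ≤ 1) (hz : ‖z‖ ≤ 1) :
    ∫ ω, z ^ servedCustomers K S t ω * y ^ busyServers K C S t ω ∂P =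
      (∫ ω, z ^ servedCustomers K S t ω ∂P) * ∫ ω, y ^ busyServers K C S t ω ∂P := by
  have h1 : ‖(1 : ℂ)‖ ≤ 1 := by simp
  have hlim := (h.tendsto_integral_gridApprox t h1 hz).mul (h.tendsto_integral_gridApprox t hy h1)
  simp only [← h.integral_gridApprox_eq_mul t hy hz, one_pow, mul_one, one_mul] at hlim
  exact tendsto_nhds_unique (h.tendsto_integral_gridApprox t hy hz) hlim

/-- The expectation of a bounded function of a discrete random variable is an absolutely
convergent series. -/
theorem summable_and_integral_comp_eq_tsum {α : Type*} [Countable α] [MeasurableSpace α]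
    [MeasurableSingletonClass α] {X : Ω → α} (hX : Measurable X) {f : α → ℂ}
    (hf : ∀ a, ‖f a‖ ≤ 1) :
    Summable (fun a => f a * (P.real (X ⁻¹' {a}) : ℂ)) ∧
      ∫ ω, f (X ω) ∂P = ∑' a, f a * (P.real (X ⁻¹' {a}) : ℂ) := by
  have : IsProbabilityMeasure (P.map X) := Measure.isProbabilityMeasure_map hX.aemeasurable
  have hfm : Measurable f := measurable_of_countable f
  have hμ : ∀ a, (P.map X).real {a} = P.real (X ⁻¹' {a}) := fun a =>
    map_measureReal_apply hX (measurableSet_singleton a)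
  constructor
  · refine Summable.of_norm_bounded (g := fun a => (P.map X).real {a}) ?_ fun a => ?_
    · exact ENNReal.summable_toReal (ne_top_of_le_ne_top (measure_ne_top (P.map X) _)
        (tsum_meas_le_meas_iUnion_of_disjoint (P.map X) (fun a => measurableSet_singleton a)
          fun a b hab => Set.disjoint_singleton.2 hab))
    · rw [hμ, norm_mul, Complex.norm_real, Real.norm_of_nonneg measureReal_nonneg]
      exact mul_le_of_le_one_left measureReal_nonneg (hf a)
  · rw [← integral_map hX.aemeasurable hfm.aestronglyMeasurable, integral_countable
      (Integrable.of_bound hfm.aestronglyMeasurable 1 (ae_of_all _ hf))]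
    refine tsum_congr fun a => ?_
    rw [hμ, Complex.real_smul, mul_comm]

theorem norm_pow_mul_pow_le_one {y z : ℂ} (hy : ‖y‖ ≤ 1) (hz : ‖z‖ ≤ 1) (n m : ℕ) :
    ‖z ^ n * y ^ m‖ ≤ 1 := by
  rw [norm_mul, norm_pow, norm_pow]
  exact mul_le_one₀ (pow_le_one₀ (norm_nonneg _) hz) (by positivity)
    (pow_le_one₀ (norm_nonneg _) hy)

theorem IsModel.summable_and_jointPGF_eq (h : IsModel K C S lam nu B P) (t : ℝ≥0) {y z : ℂ}
    (hy : ‖y‖ ≤ 1) (hz : ‖z‖ ≤ 1) :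
    Summable (fun p : ℕ × ℕ => z ^ p.1 * y ^ p.2 * (jointProb K C S P p.2 p.1 t : ℂ)) ∧
      jointPGF K C S P y z t =
        ∫ ω, z ^ servedCustomers K S t ω * y ^ busyServers K C S t ω ∂P := by
  have hXm := (h.measurable_servedCustomers t).prodMk (h.measurable_busyServers t)
  obtain ⟨h1, h2⟩ := summable_and_integral_comp_eq_tsum (P := P) hXm
    (f := fun p => z ^ p.1 * y ^ p.2) fun p => norm_pow_mul_pow_le_one hy hz p.1 p.2
  have hset : ∀ p : ℕ × ℕ, P.real ((fun ω => (servedCustomers K S t ω, busyServers K C S t ω)) ⁻¹'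
      {p}) = jointProb K C S P p.2 p.1 t := fun p => by
    unfold jointProb
    congr 1
    ext ω
    simp [Prod.ext_iff, and_comm]
  simp only [hset] at h1 h2
  exact ⟨h1, by rw [h2, h1.tsum_prod]; rfl⟩

end

end CatastropheQueue

theorem mainTheorem6 {Ω : Type*} [MeasurableSpace Ω] (P : Measure Ω) [IsProbabilityMeasure P]
    (K C : ℝ≥0 → Ω → ℕ) (S : ℕ → Ω → ℝ≥0) (lam nu : ℝ≥0) (B : Measure ℝ≥0)
    (hmodel : CatastropheQueue.IsModel K C S lam nu B P)
    (t : ℝ≥0) (y z : ℂ) (hy : ‖y‖ ≤ 1) (hz : ‖z‖ ≤ 1) :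
    -- the series defining the joint generating function converges absolutely
    Summable (fun p : ℕ × ℕ =>
      z ^ p.1 * y ^ p.2 * (CatastropheQueue.jointProb K C S P p.2 p.1 t : ℂ)) ∧
    -- the factorization
    CatastropheQueue.jointPGF K C S P y z t =
      CatastropheQueue.jointPGF K C S P 1 z t * CatastropheQueue.jointPGF K C S P y 1 t ∧
    -- the factors are the generating functions of `M(t)` and of `N(t)`
    CatastropheQueue.jointPGF K C S P 1 z t =
      ∑' n : ℕ, z ^ n * (P.real {ω | CatastropheQueue.servedCustomers K S t ω = n} : ℂ) ∧
    CatastropheQueue.jointPGF K C S P y 1 t =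
      ∑' m : ℕ, y ^ m * (P.real {ω | CatastropheQueue.busyServers K C S t ω = m} : ℂ) := by
  have h1 : ‖(1 : ℂ)‖ ≤ 1 := by simp
  have hpow : ∀ {w : ℂ}, ‖w‖ ≤ 1 → ∀ n : ℕ, ‖w ^ n‖ ≤ 1 := fun hw n => by
    rw [norm_pow]
    exact pow_le_one₀ (norm_nonneg _) hw
  obtain ⟨hs, hyz⟩ := hmodel.summable_and_jointPGF_eq t hy hz
  have hz1 := (hmodel.summable_and_jointPGF_eq t h1 hz).2
  have hy1 := (hmodel.summable_and_jointPGF_eq t hy h1).2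
  simp only [one_pow, mul_one, one_mul] at hz1 hy1
  refine ⟨hs, ?_, ?_, ?_⟩
  · rw [hyz, hz1, hy1, hmodel.integral_pow_mul_pow t hy hz]
  · rw [hz1]
    exact (CatastropheQueue.summable_and_integral_comp_eq_tsum
      (hmodel.measurable_servedCustomers t) (hpow hz)).2
  · rw [hy1]
    exact (CatastropheQueue.summable_and_integral_comp_eq_tsum
      (hmodel.measurable_busyServers t) (hpow hy)).2
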